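/- Let $A$ be a unital $C^*$-algebra. Let $A\widehat\otimes A$ be the operator space projective tensor product, i.e. the completion of the algebra $A\otimes A$ (with the usual multiplication $(a\otimes b)(c\otimes d)=ac\otimes bd$) in the norm $$\|u\|_\wedge=\inf\{\|\alpha\|\,\|v\|\,\|w\|\,\|\beta\| : u=\alpha(v\otimes w)\beta\},$$ where $p,q\in\mathbb N$, $\alpha\in\mathbb M_{1,pq}(\mathbb C)$, $\beta\in\mathbb M_{pq,1}(\mathbb C)$, $v\in \mathbb M_p(A)$, $w\in \mathbb M_q(A)$ are arbitrary and $v\otimes w=(v_{ij}\otimes w_{kl})_{(i,k),(j,l)}$. Let $A\widehat\otimes_r A$ denote the Banach algebra $A\widehat\otimes A$ equipped with the reverse involution, the continuous conjugate-linear extension of $(a\otimes b)^*=b^*\otimes a^*$; it is a unital Banach $*$-algebra. A $*$-algebra is called $*$-semisimple if the intersection of the kernels of all its $*$-representations on Hilbert spaces is $\{0\}$, and a unital $*$-algebra is called symmetric if $1+x^*x$ is invertible for every element $x$. Then: (i) $A\widehat\otimes_r A$ is $*$-semisimple if and only if $A=\mathbb C\cdot 1$; (ii) $A\widehat\otimes_r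 A$ is symmetric if and only if $A=\mathbb C\cdot 1$. -/

import Mathlib

open scoped TensorProduct

noncomputable section

universe u v

/- The C*-algebraic order (the unique one making a C*-algebra a star-ordered ring); it is only
needed to speak of Mathlib's C*-norm on `CStarMatrix n n A`, that is on `M_n(A)`. -/
attribute [local instance] CStarAlgebra.spectralOrder CStarAlgebra.spectralOrderedRing

namespace OpProj

/-! ### Norms of matrices over a C*-algebra -/

section MatrixNorms

variable {A : Type u} [CStarAlgebra A]
variable {m n : Type*}

/-- Block diagonal sum of matrices. -/
def blockDiag (v : CStarMatrix m m A) (w : CStarMatrix n n A) : CStarMatrix (m ⊕ n) (m ⊕ n) A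
  | Sum.inl i, Sum.inl j => v i j
  | Sum.inr i, Sum.inr j => w i j
  | Sum.inl _, Sum.inr _ => 0
  | Sum.inr _, Sum.inl _ => 0

/-- The matrix `(v i j * w k l)` with rows `(i, k)` and columns `(j, l)`. -/
def kron (v : CStarMatrix m m A) (w : CStarMatrix n n A) : CStarMatrix (m × n) (m × n) A :=
  fun r s => v r.1 s.1 * w r.2 s.2

/-- The matrix `v ⊗ 1`. -/
def ampLeft [DecidableEq n] (v : CStarMatrix m m A) : CStarMatrix (m × n) (m × n) A :=
  fun r s => if r.2 = s.2 then v r.1 s.1 else 0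

/-- The matrix `1 ⊗ w`. -/
def ampRight [DecidableEq m] (w : CStarMatrix n n A) : CStarMatrix (m × n) (m × n) A :=
  fun r s => if r.1 = s.1 then w r.2 s.2 else 0

variable [Fintype m] [Fintype n]

def blockDiagHom : (CStarMatrix m m A × CStarMatrix n n A) →⋆ₙₐ[ℂ]
    CStarMatrix (m ⊕ n) (m ⊕ n) A where
  toFun p := blockDiag p.1 p.2
  map_smul' c p := by
    ext (i | i) (j | j) <;> simp [blockDiag]
  map_zero' := by
    ext (i | i) (j | j) <;> simp [blockDiag]
  map_add' p q := by
    ext (i | i) (j | j) <;> simp [blockDiag]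
  map_mul' p q := by
    ext (i | i) (j | j) <;> simp [blockDiag, CStarMatrix.mul_apply]
  map_star' p := by
    ext (i | i) (j | j) <;> simp [blockDiag, CStarMatrix.star_apply]

theorem norm_blockDiag_le (v : CStarMatrix m m A) (w : CStarMatrix n n A) :
    ‖blockDiag v w‖ ≤ max ‖v‖ ‖w‖ :=
  NonUnitalStarAlgHom.norm_apply_le (blockDiagHom (A := A) (m := m) (n := n)) (v, w)

variable [DecidableEq m] [DecidableEq n]

def ampLeftHom : CStarMatrix m m A →⋆ₙₐ[ℂ] CStarMatrix (m × n) (m × n) A where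
  toFun v := ampLeft v
  map_smul' c p := by
    ext i j; simp [ampLeft]
  map_zero' := by
    ext i j; simp [ampLeft]
  map_add' p q := by
    ext i j; by_cases h : i.2 = j.2 <;> simp [ampLeft, h]
  map_mul' p q := by
    ext i j
    by_cases h : i.2 = j.2 <;>
      simp [ampLeft, CStarMatrix.mul_apply, Fintype.sum_prod_type, h]
  map_star' p := by
    ext i j
    simp [ampLeft, CStarMatrix.star_apply, apply_ite star, eq_comm]

def ampRightHom : CStarMatrix n n A →⋆ₙₐ[ℂ] CStarMatrix (m × n) (m × n) A where
  toFun v := ampRight v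
  map_smul' c p := by
    ext i j; simp [ampRight]
  map_zero' := by
    ext i j; simp [ampRight]
  map_add' p q := by
    ext i j; by_cases h : i.1 = j.1 <;> simp [ampRight, h]
  map_mul' p q := by
    ext i j
    by_cases h : i.1 = j.1 <;>
      simp [ampRight, CStarMatrix.mul_apply, Fintype.sum_prod_type_right, h]
  map_star' p := by
    ext i j
    simp [ampRight, CStarMatrix.star_apply, apply_ite star, eq_comm]

theorem norm_kron_le (v : CStarMatrix m m A) (w : CStarMatrix n n A) :
    ‖kron v w‖ ≤ ‖v‖ * ‖w‖ := by
  have h : kron v w = ampLeft (n := n) v * ampRight (m := m) w := by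
    ext i j
    simp [kron, ampLeft, ampRight, CStarMatrix.mul_apply, Fintype.sum_prod_type]
  rw [h]
  refine (norm_mul_le _ _).trans ?_
  gcongr
  · exact NonUnitalStarAlgHom.norm_apply_le (ampLeftHom (A := A) (m := m) (n := n)) v
  · exact NonUnitalStarAlgHom.norm_apply_le (ampRightHom (A := A) (m := m) (n := n)) w

end MatrixNorms

/-! ### The operator space projective tensor norm -/

section Norm

variable {A : Type u} {B : Type v} [CStarAlgebra A] [CStarAlgebra B]

/-- The element `α (v ⊗ w) β` of `A ⊗ B`, where `v ⊗ w` is the matrix `(v i j ⊗ w k l)` with rows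
`(i, k)` and columns `(j, l)`, `α` is a scalar row matrix and `β` a scalar column matrix. -/
def sandwich {I J : Type*} [Fintype I] [Fintype J] (α : EuclideanSpace ℂ (I × J))
    (v : CStarMatrix I I A) (w : CStarMatrix J J B) (β : EuclideanSpace ℂ (I × J)) : A ⊗[ℂ] B :=
  ∑ r : I × J, ∑ s : I × J, (α r * β s) • (v r.1 s.1 ⊗ₜ[ℂ] w r.2 s.2)

/-- The operator space projective tensor norm on `A ⊗ B`: the infimum of `‖α‖ ‖v‖ ‖w‖ ‖β‖` over all
factorisations `u = α (v ⊗ w) β` with `v ∈ M_p(A)`, `w ∈ M_q(B)`, `α ∈ M_{1,pq}(ℂ)` and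
`β ∈ M_{pq,1}(ℂ)`. The operator norm of a row or column matrix is its Euclidean norm. -/
def projNorm (u : A ⊗[ℂ] B) : ℝ :=
  sInf {c : ℝ | ∃ (p q : ℕ) (α : EuclideanSpace ℂ (Fin p × Fin q))
    (v : CStarMatrix (Fin p) (Fin p) A) (w : CStarMatrix (Fin q) (Fin q) B)
    (β : EuclideanSpace ℂ (Fin p × Fin q)),
    u = sandwich α v w β ∧ c = ‖α‖ * ‖v‖ * ‖w‖ * ‖β‖}

theorem projNorm_nonneg (u : A ⊗[ℂ] B) : 0 ≤ projNorm u := by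
  apply Real.sInf_nonneg
  rintro c ⟨p, q, α, v, w, β, -, rfl⟩
  positivity

theorem sandwich_reindex {I J K L : Type*} [Fintype I] [Fintype J] [Fintype K] [Fintype L]
    (e : I ≃ K) (f : J ≃ L)
    (α : EuclideanSpace ℂ (I × J)) (v : CStarMatrix I I A) (w : CStarMatrix J J B)
    (β : EuclideanSpace ℂ (I × J)) :
    sandwich α v w β =
      sandwich (LinearIsometryEquiv.piLpCongrLeft 2 ℂ ℂ (e.prodCongr f) α)
        (CStarMatrix.reindexₐ ℂ A e v) (CStarMatrix.reindexₐ ℂ B f w)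
        (LinearIsometryEquiv.piLpCongrLeft 2 ℂ ℂ (e.prodCongr f) β) := by
  let g := e.prodCongr f
  refine Fintype.sum_equiv g _ _ fun r => Fintype.sum_equiv g _ _ fun s => ?_
  change _ = (α (g.symm (g r)) * β (g.symm (g s))) •
    (v (e.symm (e r.1)) (e.symm (e s.1)) ⊗ₜ[ℂ] w (f.symm (f r.2)) (f.symm (f s.2)))
  simp only [Equiv.symm_apply_apply]

theorem projNorm_sandwich_le {I J : Type*} [Fintype I] [Fintype J]
    (α : EuclideanSpace ℂ (I × J)) (v : CStarMatrix I I A) (w : CStarMatrix J J B)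
    (β : EuclideanSpace ℂ (I × J)) :
    projNorm (sandwich α v w β) ≤ ‖α‖ * ‖v‖ * ‖w‖ * ‖β‖ := by
  classical
  let e := Fintype.equivFin I
  let f := Fintype.equivFin J
  let g := e.prodCongr f
  let α' := LinearIsometryEquiv.piLpCongrLeft 2 ℂ ℂ g α
  let β' := LinearIsometryEquiv.piLpCongrLeft 2 ℂ ℂ g β
  let v' := CStarMatrix.reindexₐ ℂ A e v
  let w' := CStarMatrix.reindexₐ ℂ B f w
  have hα : ‖α'‖ = ‖α‖ := LinearIsometryEquiv.norm_map _ _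
  have hβ : ‖β'‖ = ‖β‖ := LinearIsometryEquiv.norm_map _ _
  have hv : ‖v'‖ = ‖v‖ := StarAlgEquiv.norm_map (CStarMatrix.reindexₐ ℂ A e) v
  have hw : ‖w'‖ = ‖w‖ := StarAlgEquiv.norm_map (CStarMatrix.reindexₐ ℂ B f) w
  refine csInf_le ⟨0, ?_⟩ ⟨_, _, α', v', w', β', ?_, by rw [hα, hβ, hv, hw]⟩
  · rintro c ⟨p, q, α, v, w, β, -, rfl⟩
    positivity
  · exact sandwich_reindex e f α v w β

theorem sandwich_add {I J I' J' : Type*} [Fintype I] [Fintype J] [Fintype I'] [Fintype J']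
    (α : EuclideanSpace ℂ (I × J)) (v : CStarMatrix I I A) (w : CStarMatrix J J B)
    (β : EuclideanSpace ℂ (I × J))
    (α' : EuclideanSpace ℂ (I' × J')) (v' : CStarMatrix I' I' A) (w' : CStarMatrix J' J' B)
    (β' : EuclideanSpace ℂ (I' × J')) :
    ∃ a b : EuclideanSpace ℂ ((I ⊕ I') × (J ⊕ J')),
      ‖a‖ ^ 2 = ‖α‖ ^ 2 + ‖α'‖ ^ 2 ∧ ‖b‖ ^ 2 = ‖β‖ ^ 2 + ‖β'‖ ^ 2 ∧
      sandwich α v w β + sandwich α' v' w' β' =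
        sandwich a (blockDiag v v') (blockDiag w w') b := by
  let ext (x : EuclideanSpace ℂ (I × J)) (y : EuclideanSpace ℂ (I' × J')) :
      EuclideanSpace ℂ ((I ⊕ I') × (J ⊕ J')) :=
    WithLp.toLp 2 fun r => match r with
      | (Sum.inl i, Sum.inl j) => x (i, j)
      | (Sum.inr i, Sum.inr j) => y (i, j)
      | _ => 0
  have hext (x y) : ‖ext x y‖ ^ 2 = ‖x‖ ^ 2 + ‖y‖ ^ 2 := by
    simp [EuclideanSpace.norm_sq_eq, ext, Fintype.sum_prod_type]
  refine ⟨ext α α', ext β β', hext _ _, hext _ _, ?_⟩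
  simp [sandwich, ext, Fintype.sum_prod_type, blockDiag]

theorem sandwich_mul {I J I' J' : Type*} [Fintype I] [Fintype J] [Fintype I'] [Fintype J']
    (α : EuclideanSpace ℂ (I × J)) (v : CStarMatrix I I A) (w : CStarMatrix J J B)
    (β : EuclideanSpace ℂ (I × J))
    (α' : EuclideanSpace ℂ (I' × J')) (v' : CStarMatrix I' I' A) (w' : CStarMatrix J' J' B)
    (β' : EuclideanSpace ℂ (I' × J')) :
    ∃ a b : EuclideanSpace ℂ ((I × I') × (J × J')),
      ‖a‖ ^ 2 = ‖α‖ ^ 2 * ‖α'‖ ^ 2 ∧ ‖b‖ ^ 2 = ‖β‖ ^ 2 * ‖β'‖ ^ 2 ∧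
      sandwich α v w β * sandwich α' v' w' β' = sandwich a (kron v v') (kron w w') b := by
  let e : (I × I') × (J × J') ≃ (I × J) × (I' × J') := Equiv.prodProdProdComm I I' J J'
  let ext (x : EuclideanSpace ℂ (I × J)) (y : EuclideanSpace ℂ (I' × J')) :
      EuclideanSpace ℂ ((I × I') × (J × J')) :=
    WithLp.toLp 2 fun r => x (e r).1 * y (e r).2
  have hext (x y) : ‖ext x y‖ ^ 2 = ‖x‖ ^ 2 * ‖y‖ ^ 2 := by
    simp only [EuclideanSpace.norm_sq_eq, ext, norm_mul, mul_pow]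
    rw [Fintype.sum_mul_sum, ← Fintype.sum_prod_type' (f := fun r s => ‖x r‖ ^ 2 * ‖y s‖ ^ 2)]
    exact Equiv.sum_comp e (fun r => ‖x r.1‖ ^ 2 * ‖y r.2‖ ^ 2)
  refine ⟨ext α α', ext β β', hext _ _, hext _ _, ?_⟩
  trans ∑ R : (I × J) × (I' × J'), ∑ S : (I × J) × (I' × J'),
    ((α R.1 * β S.1) • (v R.1.1 S.1.1 ⊗ₜ[ℂ] w R.1.2 S.1.2)) *
      ((α' R.2 * β' S.2) • (v' R.2.1 S.2.1 ⊗ₜ[ℂ] w' R.2.2 S.2.2))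
  · unfold sandwich
    rw [Fintype.sum_mul_sum, Fintype.sum_prod_type (α₁ := I × J) (α₂ := I' × J')]
    refine Finset.sum_congr rfl fun i _ => ?_
    refine Finset.sum_congr rfl fun j _ => ?_
    rw [Fintype.sum_mul_sum, Fintype.sum_prod_type (α₁ := I × J) (α₂ := I' × J')]
  · symm
    unfold sandwich
    refine Fintype.sum_equiv e _ _ fun r => ?_
    refine Fintype.sum_equiv e _ _ fun s => ?_
    simp only [ext, kron, smul_mul_smul_comm,
      Algebra.TensorProduct.tmul_mul_tmul, e, Equiv.prodProdProdComm_apply]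
    congr 1
    exact mul_mul_mul_comm _ _ _ _

theorem sandwich_smul {I J : Type*} [Fintype I] [Fintype J] (s t a b : ℂ)
    (α : EuclideanSpace ℂ (I × J)) (v : CStarMatrix I I A) (w : CStarMatrix J J B)
    (β : EuclideanSpace ℂ (I × J)) :
    sandwich (s • α) (a • v) (b • w) (t • β) = (s * t * a * b) • sandwich α v w β := by
  simp only [sandwich, Finset.smul_sum]
  refine Finset.sum_congr rfl fun r _ => Finset.sum_congr rfl fun r' _ => ?_
  simp only [PiLp.smul_apply, CStarMatrix.smul_apply, TensorProduct.smul_tmul',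
    TensorProduct.tmul_smul, smul_smul, smul_eq_mul]
  congr 1
  ring_nf

theorem exists_sandwich (u : A ⊗[ℂ] B) :
    ∃ (p q : ℕ) (α : EuclideanSpace ℂ (Fin p × Fin q))
      (v : CStarMatrix (Fin p) (Fin p) A) (w : CStarMatrix (Fin q) (Fin q) B)
      (β : EuclideanSpace ℂ (Fin p × Fin q)), u = sandwich α v w β := by
  suffices h : ∃ (I J : Type) (_ : Fintype I) (_ : Fintype J) (α : EuclideanSpace ℂ (I × J))
      (v : CStarMatrix I I A) (w : CStarMatrix J J B)
      (β : EuclideanSpace ℂ (I × J)), u = sandwich α v w β by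
    obtain ⟨I, J, _, _, α, v, w, β, rfl⟩ := h
    let e := Fintype.equivFin I
    let f := Fintype.equivFin J
    let g := e.prodCongr f
    refine ⟨_, _, LinearIsometryEquiv.piLpCongrLeft 2 ℂ ℂ g α, CStarMatrix.reindexₐ ℂ A e v,
      CStarMatrix.reindexₐ ℂ B f w, LinearIsometryEquiv.piLpCongrLeft 2 ℂ ℂ g β,
      sandwich_reindex e f α v w β⟩
  induction u with
  | zero => exact ⟨Empty, Empty, inferInstance, inferInstance, 0, 0, 0, 0, by simp [sandwich]⟩
  | tmul a b =>
    exact ⟨Unit, Unit, inferInstance, inferInstance, WithLp.toLp 2 1,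
      fun _ _ => a, fun _ _ => b, WithLp.toLp 2 1,
      by simp [sandwich]⟩
  | add x y hx hy =>
    obtain ⟨I, J, _, _, α, v, w, β, rfl⟩ := hx
    obtain ⟨I', J', _, _, α', v', w', β', rfl⟩ := hy
    obtain ⟨a, b, -, -, h⟩ := sandwich_add α v w β α' v' w' β'
    exact ⟨_, _, inferInstance, inferInstance, a, _, _, b, h⟩

/-- Normalised factorisations. -/
theorem exists_normalized {u : A ⊗[ℂ] B} {c : ℝ} (hc : projNorm u < c) :
    ∃ (p q : ℕ) (α : EuclideanSpace ℂ (Fin p × Fin q))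
      (v : CStarMatrix (Fin p) (Fin p) A) (w : CStarMatrix (Fin q) (Fin q) B)
      (β : EuclideanSpace ℂ (Fin p × Fin q)), u = sandwich α v w β ∧
      ‖α‖ ^ 2 ≤ c ∧ ‖β‖ ^ 2 ≤ c ∧ ‖v‖ ≤ 1 ∧ ‖w‖ ≤ 1 := by
  have hc0 : 0 ≤ c := (projNorm_nonneg u).trans hc.le
  obtain ⟨p₀, q₀, α₀, v₀, w₀, β₀, h₀⟩ := exists_sandwich u
  obtain ⟨_, ⟨p, q, α, v, w, β, hu, rfl⟩, hlt⟩ :=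
    exists_lt_of_csInf_lt (by exact ⟨_, p₀, q₀, α₀, v₀, w₀, β₀, h₀, rfl⟩) hc
  by_cases hz : u = 0
  · exact ⟨0, 0, 0, 0, 0, 0, by simp [sandwich, hz], by simpa, by simpa, by simp, by simp⟩
  have hα : ‖α‖ ≠ 0 := by
    rw [norm_ne_zero_iff]; rintro rfl; exact hz (by rw [hu]; simp [sandwich])
  have hβ : ‖β‖ ≠ 0 := by
    rw [norm_ne_zero_iff]; rintro rfl; exact hz (by rw [hu]; simp [sandwich])
  have hv : ‖v‖ ≠ 0 := by
    rw [norm_ne_zero_iff]; rintro rfl; exact hz (by rw [hu]; simp [sandwich])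
  have hw : ‖w‖ ≠ 0 := by
    rw [norm_ne_zero_iff]; rintro rfl; exact hz (by rw [hu]; simp [sandwich])
  have hnn : 0 ≤ ‖α‖ * ‖v‖ * ‖w‖ * ‖β‖ := by positivity
  set d := √(‖α‖ * ‖v‖ * ‖w‖ * ‖β‖) with hd
  have hdd : d ^ 2 = ‖α‖ * ‖v‖ * ‖w‖ * ‖β‖ := Real.sq_sqrt hnn
  have hd0 : 0 ≤ d := Real.sqrt_nonneg _
  refine ⟨p, q, ((d / ‖α‖ : ℝ) : ℂ) • α, ((‖v‖⁻¹ : ℝ) : ℂ) • v, ((‖w‖⁻¹ : ℝ) : ℂ) • w,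
    ((d / ‖β‖ : ℝ) : ℂ) • β, ?_, ?_, ?_, ?_, ?_⟩
  · rw [sandwich_smul, hu]
    have : d / ‖α‖ * (d / ‖β‖) * ‖v‖⁻¹ * ‖w‖⁻¹ = 1 := by
      field_simp
      rw [hdd]; ring_nf
    rw [← Complex.ofReal_mul, ← Complex.ofReal_mul, ← Complex.ofReal_mul, this]
    simp
  · rw [norm_smul, Complex.norm_real, Real.norm_of_nonneg (by positivity),
      div_mul_cancel₀ _ hα, hdd]
    exact hlt.le
  · rw [norm_smul, Complex.norm_real, Real.norm_of_nonneg (by positivity),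
      div_mul_cancel₀ _ hβ, hdd]
    exact hlt.le
  · rw [norm_smul, Complex.norm_real, Real.norm_of_nonneg (by positivity), inv_mul_cancel₀ hv]
  · rw [norm_smul, Complex.norm_real, Real.norm_of_nonneg (by positivity), inv_mul_cancel₀ hw]

theorem projNorm_le_of_normalized {I J : Type*} [Fintype I] [Fintype J] {c : ℝ}
    {α : EuclideanSpace ℂ (I × J)} {v : CStarMatrix I I A} {w : CStarMatrix J J B}
    {β : EuclideanSpace ℂ (I × J)} (hc : 0 ≤ c) (hα : ‖α‖ ^ 2 ≤ c) (hβ : ‖β‖ ^ 2 ≤ c)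
    (hv : ‖v‖ ≤ 1) (hw : ‖w‖ ≤ 1) : projNorm (sandwich α v w β) ≤ c := by
  refine (projNorm_sandwich_le α v w β).trans ?_
  have hα' : ‖α‖ ≤ √c := Real.le_sqrt_of_sq_le hα
  have hβ' : ‖β‖ ≤ √c := Real.le_sqrt_of_sq_le hβ
  calc ‖α‖ * ‖v‖ * ‖w‖ * ‖β‖ ≤ √c * 1 * 1 * √c := by gcongr
    _ = c := by rw [mul_one, mul_one, Real.mul_self_sqrt hc]

theorem projNorm_zero : projNorm (0 : A ⊗[ℂ] B) = 0 := by
  refine le_antisymm ?_ (projNorm_nonneg _)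
  have h := projNorm_sandwich_le (A := A) (B := B) (I := Fin 0) (J := Fin 0) 0 0 0 0
  simpa [sandwich] using h

theorem projNorm_add_le (x y : A ⊗[ℂ] B) : projNorm (x + y) ≤ projNorm x + projNorm y := by
  refine le_of_forall_pos_le_add fun ε hε => ?_
  have hx0 := projNorm_nonneg x
  have hy0 := projNorm_nonneg y
  obtain ⟨p, q, α, v, w, β, hx, h1, h2, h3, h4⟩ :=
    exists_normalized (u := x) (c := projNorm x + ε / 2) (by linarith)
  obtain ⟨p', q', α', v', w', β', hy, h1', h2', h3', h4'⟩ :=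
    exists_normalized (u := y) (c := projNorm y + ε / 2) (by linarith)
  obtain ⟨a, b, ha, hb, hab⟩ := sandwich_add α v w β α' v' w' β'
  rw [← hx, ← hy] at hab
  rw [hab]
  exact projNorm_le_of_normalized (by linarith) (by linarith) (by linarith)
    ((norm_blockDiag_le _ _).trans (max_le h3 h3'))
    ((norm_blockDiag_le _ _).trans (max_le h4 h4'))

theorem projNorm_smul_le (c : ℂ) (x : A ⊗[ℂ] B) : projNorm (c • x) ≤ ‖c‖ * projNorm x := by
  refine le_of_forall_pos_le_add fun ε hε => ?_
  have hx0 := projNorm_nonneg x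
  have hδ : 0 < ε / (‖c‖ + 1) := by positivity
  obtain ⟨p, q, α, v, w, β, hx, h1, h2, h3, h4⟩ :=
    exists_normalized (u := x) (c := projNorm x + ε / (‖c‖ + 1)) (by linarith)
  have key := sandwich_smul c 1 1 1 α v w β
  have h0 : 0 ≤ projNorm x + ε / (‖c‖ + 1) := by positivity
  have h1' := Real.le_sqrt_of_sq_le h1
  have h2' := Real.le_sqrt_of_sq_le h2
  simp only [one_smul, mul_one, ← hx] at key
  rw [← key]
  refine (projNorm_sandwich_le _ _ _ _).trans ?_
  calc ‖c • α‖ * ‖v‖ * ‖w‖ * ‖β‖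
      ≤ (‖c‖ * √(projNorm x + ε / (‖c‖ + 1))) * 1 * 1 * √(projNorm x + ε / (‖c‖ + 1)) := by
        rw [norm_smul]; gcongr
    _ = ‖c‖ * (projNorm x + ε / (‖c‖ + 1)) := by
        rw [mul_one, mul_one, mul_assoc, Real.mul_self_sqrt h0]
    _ = ‖c‖ * projNorm x + ε * (‖c‖ / (‖c‖ + 1)) := by ring
    _ ≤ ‖c‖ * projNorm x + ε * 1 := by
        gcongr
        rw [div_le_one (by positivity)]
        linarith
    _ = ‖c‖ * projNorm x + ε := by rw [mul_one]

theorem projNorm_mul_le (x y : A ⊗[ℂ] B) : projNorm (x * y) ≤ projNorm x * projNorm y := by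
  have hx0 := projNorm_nonneg x
  have hy0 := projNorm_nonneg y
  have key : ∀ s, projNorm x < s → ∀ t, projNorm y < t → projNorm (x * y) ≤ s * t := by
    intro s hs t ht
    obtain ⟨p, q, α, v, w, β, hx, h1, h2, h3, h4⟩ := exists_normalized hs
    obtain ⟨p', q', α', v', w', β', hy, h1', h2', h3', h4'⟩ := exists_normalized ht
    obtain ⟨a, b, ha, hb, hab⟩ := sandwich_mul α v w β α' v' w' β'
    have hs0 := hx0.trans hs.le
    have ht0 := hy0.trans ht.le
    rw [← hx, ← hy] at hab
    rw [hab]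
    refine projNorm_le_of_normalized (by positivity) (by rw [ha]; gcongr) (by rw [hb]; gcongr)
      ((norm_kron_le _ _).trans ?_) ((norm_kron_le _ _).trans ?_)
    · exact mul_le_one₀ h3 (norm_nonneg _) h3'
    · exact mul_le_one₀ h4 (norm_nonneg _) h4'
  have lim : Filter.Tendsto (fun ε : ℝ => (projNorm x + ε) * (projNorm y + ε))
      (nhdsWithin 0 (Set.Ioi 0)) (nhds (projNorm x * projNorm y)) := by
    have : ContinuousAt (fun ε : ℝ => (projNorm x + ε) * (projNorm y + ε)) 0 := by fun_prop
    have h := this.tendsto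
    simp only [add_zero] at h
    exact h.mono_left nhdsWithin_le_nhds
  refine ge_of_tendsto lim ?_
  filter_upwards [self_mem_nhdsWithin] with ε hε
  have hε' : 0 < ε := hε
  exact key _ (by linarith) _ (by linarith)

/-- The operator space projective tensor norm as a seminorm. -/
def projSeminorm (A : Type u) (B : Type v) [CStarAlgebra A] [CStarAlgebra B] :
    Seminorm ℂ (A ⊗[ℂ] B) :=
  Seminorm.ofSMulLE projNorm projNorm_zero projNorm_add_le projNorm_smul_le

end Norm

/-! ### The reverse involution on the algebraic tensor product -/

section Reverse

variable {A : Type u} [CStarAlgebra A]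

/-- The reverse involution on `A ⊗ A`, with `(a ⊗ b)* = b* ⊗ a*`: the flip followed by
`a ⊗ b ↦ a* ⊗ b*`. -/
def revStar (x : A ⊗[ℂ] A) : A ⊗[ℂ] A := star (TensorProduct.comm ℂ A A x)

theorem revStar_tmul (a b : A) : revStar (a ⊗ₜ[ℂ] b) = star b ⊗ₜ[ℂ] star a := by
  simp [revStar]

theorem revStar_add (x y : A ⊗[ℂ] A) : revStar (x + y) = revStar x + revStar y := by
  simp [revStar]

theorem revStar_smul (c : ℂ) (x : A ⊗[ℂ] A) : revStar (c • x) = star c • revStar x := by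
  simp only [revStar, map_smul, star_smul]

theorem revStar_zero : revStar (0 : A ⊗[ℂ] A) = 0 := by
  simp [revStar]

theorem revStar_revStar (x : A ⊗[ℂ] A) : revStar (revStar x) = x := by
  induction x with
  | zero => simp only [revStar_zero]
  | tmul a b => simp only [revStar_tmul, star_star]
  | add x y hx hy => simp only [revStar_add, hx, hy]

theorem revStar_mul (x y : A ⊗[ℂ] A) : revStar (x * y) = revStar y * revStar x := by
  induction x with
  | zero => simp only [revStar_zero, zero_mul, mul_zero]
  | add x x' hx hx' => simp only [revStar_add, add_mul, mul_add, hx, hx']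
  | tmul a b =>
    induction y with
    | zero => simp only [revStar_zero, zero_mul, mul_zero]
    | add y y' hy hy' => simp only [revStar_add, add_mul, mul_add, hy, hy']
    | tmul c d => simp only [revStar_tmul, Algebra.TensorProduct.tmul_mul_tmul, star_mul]

theorem projNorm_revStar_le (x : A ⊗[ℂ] A) : projNorm (revStar x) ≤ projNorm x := by
  refine le_of_forall_pos_le_add fun ε hε => ?_
  have hx0 := projNorm_nonneg x
  obtain ⟨p, q, α, v, w, β, hx, h1, h2, h3, h4⟩ :=
    exists_normalized (u := x) (c := projNorm x + ε) (by linarith)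
  let ext (y : EuclideanSpace ℂ (Fin p × Fin q)) : EuclideanSpace ℂ (Fin q × Fin p) :=
    WithLp.toLp 2 fun r => star (y r.swap)
  have hext (y) : ‖ext y‖ ^ 2 = ‖y‖ ^ 2 := by
    simp only [EuclideanSpace.norm_sq_eq, ext, norm_star]
    exact Equiv.sum_comp (Equiv.prodComm _ _) (fun r => ‖y r‖ ^ 2)
  have key : revStar x = sandwich (ext β) (star w) (star v) (ext α) := by
    let F : A ⊗[ℂ] A →+ A ⊗[ℂ] A := ⟨⟨revStar, revStar_zero⟩, revStar_add⟩
    have hF (y) : revStar y = F y := rfl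
    rw [hx, hF]
    simp only [sandwich, map_sum]
    simp only [← hF, revStar_smul, revStar_tmul]
    rw [Finset.sum_comm]
    refine Fintype.sum_equiv (Equiv.prodComm _ _) _ _ fun r =>
      Fintype.sum_equiv (Equiv.prodComm _ _) _ _ fun s => ?_
    simp [ext, CStarMatrix.star_apply, mul_comm]
  rw [key]
  exact projNorm_le_of_normalized (by linarith) (by rw [hext]; exact h2) (by rw [hext]; exact h1)
    (by rwa [norm_star]) (by rwa [norm_star])

theorem projNorm_revStar (x : A ⊗[ℂ] A) : projNorm (revStar x) = projNorm x :=
  le_antisymm (projNorm_revStar_le x) (by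
    conv_lhs => rw [← revStar_revStar x]
    exact projNorm_revStar_le _)

end Reverse

end OpProj

/-! ### The Banach algebra `A ⊗̂ B` and the Banach *-algebra `A ⊗̂_r A` -/

/-- The algebraic tensor product `A ⊗ B` with the usual multiplication
`(a ⊗ b)(c ⊗ d) = ac ⊗ bd`, normed by the operator space projective tensor norm. -/
def OpTensor (A : Type u) (B : Type v) [CStarAlgebra A] [CStarAlgebra B] : Type (max u v) :=
  A ⊗[ℂ] B

namespace OpTensor

variable (A : Type u) (B : Type v) [CStarAlgebra A] [CStarAlgebra B]

instance : Ring (OpTensor A B) := inferInstanceAs (Ring (A ⊗[ℂ] B))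

instance : Algebra ℂ (OpTensor A B) := inferInstanceAs (Algebra ℂ (A ⊗[ℂ] B))

instance : SeminormedAddCommGroup (OpTensor A B) :=
  AddGroupSeminorm.toSeminormedAddCommGroup (OpProj.projSeminorm A B).toAddGroupSeminorm

instance : SeminormedRing (OpTensor A B) where
  __ := (inferInstance : Ring (OpTensor A B))
  __ := (inferInstance : SeminormedAddCommGroup (OpTensor A B))
  norm_mul_le x y := OpProj.projNorm_mul_le x y

instance : NormedAlgebra ℂ (OpTensor A B) where
  norm_smul_le c x := OpProj.projNorm_smul_le c x

end OpTensor

/-- The operator space projective tensor product `A ⊗̂ B`, the completion of `A ⊗ B`. -/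
def OpProjTensor (A : Type u) (B : Type v) [CStarAlgebra A] [CStarAlgebra B] : Type (max u v) :=
  UniformSpace.Completion (OpTensor A B)

namespace OpProjTensor

variable (A : Type u) (B : Type v) [CStarAlgebra A] [CStarAlgebra B]

instance : NormedRing (OpProjTensor A B) :=
  inferInstanceAs (NormedRing (UniformSpace.Completion (OpTensor A B)))

instance : CompleteSpace (OpProjTensor A B) :=
  inferInstanceAs (CompleteSpace (UniformSpace.Completion (OpTensor A B)))

instance : Algebra ℂ (OpProjTensor A B) :=
  inferInstanceAs (Algebra ℂ (UniformSpace.Completion (OpTensor A B)))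

instance : NormedAlgebra ℂ (OpProjTensor A B) where
  norm_smul_le c x := norm_smul_le (β := UniformSpace.Completion (OpTensor A B)) c x

end OpProjTensor

/-- The Banach *-algebra `A ⊗̂_r A`: the Banach algebra `A ⊗̂ A` with the reverse involution. -/
def RevTensor (A : Type u) [CStarAlgebra A] : Type u := OpProjTensor A A

namespace RevTensor

variable (A : Type u) [CStarAlgebra A]

instance : NormedRing (RevTensor A) := inferInstanceAs (NormedRing (OpProjTensor A A))

instance : CompleteSpace (RevTensor A) := inferInstanceAs (CompleteSpace (OpProjTensor A A))

instance : NormedAlgebra ℂ (RevTensor A) := inferInstanceAs (NormedAlgebra ℂ (OpProjTensor A A))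

variable {A}

/-- The canonical map from `A ⊗ A`. -/
def ofTensor (x : A ⊗[ℂ] A) : RevTensor A :=
  UniformSpace.Completion.coe' (α := OpTensor A A) x

/-- The reverse involution on the normed algebra `A ⊗ A`. -/
def preStar (x : OpTensor A A) : OpTensor A A := OpProj.revStar (A := A) x

theorem preStar_isometry : Isometry (preStar (A := A)) := by
  refine AddMonoidHomClass.isometry_of_norm
    (AddMonoidHom.mk' (preStar (A := A)) (fun x y => OpProj.revStar_add (A := A) x y)) fun x => ?_
  exact OpProj.projNorm_revStar (A := A) x

/-- The extension of the reverse involution to the completion. -/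
instance : Star (RevTensor A) where
  star x := UniformSpace.Completion.map (preStar (A := A)) x

theorem star_ofTensor (x : A ⊗[ℂ] A) : star (ofTensor x) = ofTensor (OpProj.revStar x) :=
  UniformSpace.Completion.map_coe preStar_isometry.uniformContinuous x

theorem ofTensor_add (x y : A ⊗[ℂ] A) : ofTensor (x + y) = ofTensor x + ofTensor y :=
  UniformSpace.Completion.coe_add (α := OpTensor A A) x y

theorem ofTensor_mul (x y : A ⊗[ℂ] A) : ofTensor (x * y) = ofTensor x * ofTensor y :=
  UniformSpace.Completion.coe_mul (α := OpTensor A A) x y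

theorem ofTensor_smul (c : ℂ) (x : A ⊗[ℂ] A) : ofTensor (c • x) = c • ofTensor x :=
  UniformSpace.Completion.coe_smul (X := OpTensor A A) c x

theorem norm_ofTensor (x : A ⊗[ℂ] A) : ‖ofTensor x‖ = OpProj.projNorm x :=
  UniformSpace.Completion.norm_coe (E := OpTensor A A) x

theorem denseRange_ofTensor : DenseRange (ofTensor (A := A)) :=
  UniformSpace.Completion.denseRange_coe (α := OpTensor A A)

theorem continuous_star' : Continuous (star : RevTensor A → RevTensor A) :=
  UniformSpace.Completion.continuous_map (f := preStar (A := A))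

instance : StarRing (RevTensor A) where
  star_involutive x := by
    refine denseRange_ofTensor.induction_on (p := fun x => star (star x) = x) x
      (isClosed_eq (continuous_star'.comp continuous_star') continuous_id) fun a => ?_
    rw [star_ofTensor, star_ofTensor, OpProj.revStar_revStar]
  star_mul x y := by
    refine denseRange_ofTensor.induction_on₂ (p := fun x y => star (x * y) = star y * star x)
      (isClosed_eq (continuous_star'.comp continuous_mul)
        ((continuous_star'.comp continuous_snd).mul (continuous_star'.comp continuous_fst)))
      (fun a b => ?_) x y
    rw [← ofTensor_mul, star_ofTensor, star_ofTensor, star_ofTensor, OpProj.revStar_mul,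
      ofTensor_mul]
  star_add x y := by
    refine denseRange_ofTensor.induction_on₂ (p := fun x y => star (x + y) = star x + star y)
      (isClosed_eq (continuous_star'.comp continuous_add)
        ((continuous_star'.comp continuous_fst).add (continuous_star'.comp continuous_snd)))
      (fun a b => ?_) x y
    rw [← ofTensor_add, star_ofTensor, star_ofTensor, star_ofTensor, OpProj.revStar_add,
      ofTensor_add]

instance : StarModule ℂ (RevTensor A) where
  star_smul c x := by
    refine denseRange_ofTensor.induction_on (p := fun x => star (c • x) = star c • star x) x
      (isClosed_eq (continuous_star'.comp (continuous_const_smul c))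
        (continuous_star'.const_smul (star c))) fun a => ?_
    rw [← ofTensor_smul, star_ofTensor, star_ofTensor, OpProj.revStar_smul, ofTensor_smul]

instance : NormedStarGroup (RevTensor A) where
  norm_star_le x := by
    refine denseRange_ofTensor.induction_on (p := fun x => ‖star x‖ ≤ ‖x‖) x
      (isClosed_le continuous_star'.norm continuous_norm) fun a => ?_
    rw [star_ofTensor, norm_ofTensor, norm_ofTensor, OpProj.projNorm_revStar]

end RevTensor

/-! ### *-semisimple and symmetric *-algebras -/

/-- The *-radical of a complex *-algebra: the intersection of the kernels of all its
*-representations on Hilbert spaces. (Hilbert spaces in the universe of `X` suffice, since every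
*-representation is a direct sum of a zero one and of cyclic ones.) -/
def starRadical (X : Type u) [Ring X] [StarRing X] [Algebra ℂ X] : Set X :=
  {x | ∀ (H : Type u) [NormedAddCommGroup H] [InnerProductSpace ℂ H] [CompleteSpace H]
    (π : X →⋆ₙₐ[ℂ] (H →L[ℂ] H)), π x = 0}

/-- A *-algebra is *-semisimple if its *-radical is zero. -/
def IsStarSemisimple (X : Type u) [Ring X] [StarRing X] [Algebra ℂ X] : Prop :=
  starRadical X = {0}

/-- A unital *-algebra is symmetric if `1 + x* x` is invertible for every `x`. -/
def IsSymmetricStarAlgebra (X : Type u) [Ring X] [StarRing X] : Prop :=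
  ∀ x : X, IsUnit (1 + star x * x)

end

/-!
# The reverse involution on `A ⊗̂ A` is degenerate unless `A = ℂ`

If `A` consists of scalars, so does `A ⊗̂_r A`, which is then `0` or `ℂ` with complex conjugation,
and both properties are immediate. For the converse, `A ⊗̂_r A` is tested against the functionals
`φ ⊗ ψ` with `φ, ψ` in the dual of `A`. They are bounded for the projective norm
(`OpProj.norm_functionalTmul_le`), because bounded functionals are completely bounded and Kronecker
products of scalar matrices are submultiplicative in norm.

*Semisimplicity.* Let `u` be a unitary of `A` and `π` a *-representation. Since `(u ⊗ 1)* (u ⊗ 1)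
= u ⊗ u*` is self-adjoint of norm at most `1`, a spectral radius argument shows that `π(u ⊗ 1)` is
a contraction, and so is `π(u* ⊗ 1)`. They are inverse to each other under the projection `π(1 ⊗
1)`, hence adjoint to each other (`star_eq_of_mul_eq_projection`). But the adjoint of `π(u* ⊗ 1)`
is `π(1 ⊗ u)`, so `u ⊗ 1 - 1 ⊗ u` lies in the *-radical (`RevTensor.sub_mem_starRadical`). If the
*-radical vanishes, the functionals `φ ⊗ ψ` with `ψ(1) = 1` show `u = ψ(u) 1`, and the unitaries
span `A`.

*Symmetry.* Let `a` be self-adjoint with spectral values `s ≠ t`, which are real. As `a - s` has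
no left inverse, the Hahn-Banach theorem gives a functional `φ` with `φ(1) ≠ 0` and `φ(ca) = s
φ(c)` for all `c`; let `ψ` be such a functional for `t`. The element `x = (s - t)⁻¹ (a ⊗ 1 - 1 ⊗
a)` satisfies `x* = -x` and `(φ ⊗ ψ)(yx) = (φ ⊗ ψ)(y)` for all `y`, so `φ ⊗ ψ` vanishes on the
left ideal generated by `1 + x* x = 1 - x²` but not at `1`. Hence symmetry forces each
self-adjoint element to have a one-point spectrum, that is, to be a scalar.
-/

noncomputable section

-- The norm of `CStarMatrix` and inequalities between elements of a C*-algebra use this order.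
attribute [local instance] CStarAlgebra.spectralOrder CStarAlgebra.spectralOrderedRing

/-! ### Bounded functionals on the projective tensor product -/

namespace OpProj

section Functionals

variable {A : Type u} {B : Type v} [CStarAlgebra A] [CStarAlgebra B]

open scoped InnerProductSpace in
/-- The norm of a matrix over `A`, defined through the Hilbert module `Aⁿ`, controls its bilinear
form on scalar vectors. -/
theorem norm_bilin_le {I : Type*} [Fintype I] (x y : EuclideanSpace ℂ I)
    (v : CStarMatrix I I A) :
    ‖∑ i, ∑ j, (x i * y j) • v i j‖ ≤ ‖x‖ * ‖v‖ * ‖y‖ := by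
  have norm_vec (z : EuclideanSpace ℂ I) :
      ‖(WithCStarModule.equiv A (I → A)).symm (fun i => z i • (1 : A))‖ ≤ ‖z‖ := by
    rw [WithCStarModule.pi_norm]
    refine Real.sqrt_le_left (norm_nonneg z) |>.mpr ?_
    rw [EuclideanSpace.norm_sq_eq]
    refine (norm_sum_le _ _).trans (Finset.sum_le_sum fun i _ => ?_)
    rw [WithCStarModule.equiv_symm_pi_apply, WithCStarModule.inner_def]
    refine (CStarRing.norm_self_mul_star).trans_le ?_
    rw [← sq, norm_smul]
    have h1 : ‖(1 : A)‖ ≤ 1 := by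
      rcases subsingleton_or_nontrivial A with h | h
      · simp [Subsingleton.elim (1 : A) 0]
      · exact CStarRing.norm_one.le
    gcongr
    exact mul_le_of_le_one_right (norm_nonneg _) h1
  -- The `A`-valued inner product is conjugate-linear in its first argument.
  let y' : EuclideanSpace ℂ I := WithLp.toLp 2 fun i => star (y i)
  have hy' : ‖y'‖ = ‖y‖ := by simp [EuclideanSpace.norm_eq, y']
  let X := (WithCStarModule.equiv A (I → A)).symm (fun i => x i • (1 : A))
  let Y := (WithCStarModule.equiv A (I → A)).symm (fun i => y' i • (1 : A))
  have key : ∑ i, ∑ j, (x i * y j) • v i j = ⟪Y, CStarMatrix.toCLM v X⟫_A := by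
    rw [WithCStarModule.pi_inner, Finset.sum_comm]
    refine Finset.sum_congr rfl fun j _ => ?_
    rw [CStarMatrix.toCLM_apply_eq_sum, WithCStarModule.inner_def]
    simp [X, Y, y', WithCStarModule.equiv_symm_pi_apply, Finset.smul_sum, smul_smul, mul_comm]
  rw [key]
  calc _ ≤ ‖Y‖ * ‖CStarMatrix.toCLM v X‖ := CStarModule.norm_inner_le _
    _ ≤ ‖y‖ * (‖v‖ * ‖x‖) := by
      gcongr
      · exact hy' ▸ norm_vec y'
      · exact ((CStarMatrix.toCLM v).le_opNorm X).trans (by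
          rw [CStarMatrix.norm_def]; gcongr; exact norm_vec x)
    _ = _ := by ring

/-- Bounded functionals are completely bounded, with the same bound: pairing the scalar matrix
`φ(v)` with two scalar vectors gives the value of `φ` at the pairing of `v` with them. -/
theorem norm_map_functional_le {I : Type*} [Fintype I] (φ : A →L[ℂ] ℂ) (v : CStarMatrix I I A) :
    ‖(CStarMatrix.ofMatrix fun i j => φ (v i j) : CStarMatrix I I ℂ)‖ ≤ ‖φ‖ * ‖v‖ := by
  have norm_vec (z : WithCStarModule ℂ (I → ℂ)) :
      ‖(WithLp.toLp 2 (fun i => z i) : EuclideanSpace ℂ I)‖ = ‖z‖ := by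
    rw [EuclideanSpace.norm_eq, WithCStarModule.pi_norm]
    congr 1
    simp only [WithCStarModule.inner_def]
    simp only [RCLike.star_def, RCLike.mul_conj]
    norm_cast
    exact (abs_of_nonneg (Finset.sum_nonneg fun i _ => sq_nonneg _)).symm
  refine CStarMatrix.norm_le_of_forall_inner_le
    (C := ⟨‖φ‖ * ‖v‖, by positivity⟩) fun x y => ?_
  let x' : EuclideanSpace ℂ I := WithLp.toLp 2 fun i => x i
  let y' : EuclideanSpace ℂ I := WithLp.toLp 2 fun i => star (y i)
  have hy' : ‖y'‖ = ‖y‖ := by rw [← norm_vec y]; simp [EuclideanSpace.norm_eq, y']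
  have key : inner ℂ y (CStarMatrix.toCLM
      (CStarMatrix.ofMatrix fun i j => φ (v i j) : CStarMatrix I I ℂ) x) =
      φ (∑ i, ∑ j, (x' i * y' j) • v i j) := by
    rw [WithCStarModule.pi_inner, Finset.sum_comm, map_sum]
    refine Finset.sum_congr rfl fun j _ => ?_
    rw [CStarMatrix.toCLM_apply_eq_sum, WithCStarModule.inner_def]
    simp only [WithCStarModule.equiv_symm_pi_apply, Finset.sum_mul, map_sum, map_smul, x', y',
      smul_eq_mul]
    exact Finset.sum_congr rfl fun i _ => mul_right_comm (x i) (φ (v i j)) (star (y j))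
  rw [key]
  calc _ ≤ ‖φ‖ * (‖x'‖ * ‖v‖ * ‖y'‖) :=
        (φ.le_opNorm _).trans (by gcongr; exact norm_bilin_le _ _ _)
    _ = ‖φ‖ * ‖v‖ * ‖x‖ * ‖y‖ := by rw [hy', norm_vec x]; ring

/-- The functional `φ ⊗ ψ` on the algebraic tensor product. -/
def functionalTmul (φ : A →L[ℂ] ℂ) (ψ : B →L[ℂ] ℂ) : A ⊗[ℂ] B →ₗ[ℂ] ℂ :=
  LinearMap.mul' ℂ ℂ ∘ₗ TensorProduct.map (φ : A →ₗ[ℂ] ℂ) (ψ : B →ₗ[ℂ] ℂ)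

theorem functionalTmul_tmul (φ : A →L[ℂ] ℂ) (ψ : B →L[ℂ] ℂ) (a : A) (b : B) :
    functionalTmul φ ψ (a ⊗ₜ b) = φ a * ψ b := by
  simp [functionalTmul]

/-- `φ ⊗ ψ` is bounded for the projective norm: on `α (v ⊗ w) β` it is the bilinear form of the
Kronecker product of the scalar matrices `φ(v)` and `ψ(w)`. -/
theorem norm_functionalTmul_le (φ : A →L[ℂ] ℂ) (ψ : B →L[ℂ] ℂ) (u : A ⊗[ℂ] B) :
    ‖functionalTmul φ ψ u‖ ≤ ‖φ‖ * ‖ψ‖ * projNorm u := by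
  refine le_of_forall_pos_le_add fun ε hε => ?_
  have hδ : 0 < ε / (‖φ‖ * ‖ψ‖ + 1) := by positivity
  have h0 := projNorm_nonneg u
  obtain ⟨p, q, α, v, w, β, hu, h1, h2, h3, h4⟩ :=
    exists_normalized (u := u) (c := projNorm u + ε / (‖φ‖ * ‖ψ‖ + 1)) (by linarith)
  set c := projNorm u + ε / (‖φ‖ * ‖ψ‖ + 1) with hc
  have hc0 : 0 ≤ c := by positivity
  let M : CStarMatrix (Fin p) (Fin p) ℂ := CStarMatrix.ofMatrix fun i j => φ (v i j)
  let N : CStarMatrix (Fin q) (Fin q) ℂ := CStarMatrix.ofMatrix fun i j => ψ (w i j)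
  have hM : ‖M‖ ≤ ‖φ‖ * 1 := (norm_map_functional_le φ v).trans (by gcongr)
  have hN : ‖N‖ ≤ ‖ψ‖ * 1 := (norm_map_functional_le ψ w).trans (by gcongr)
  have key : functionalTmul φ ψ u = ∑ r, ∑ s, (α r * β s) • kron M N r s := by
    rw [hu, sandwich]
    simp only [map_sum, map_smul, functionalTmul_tmul]
    rfl
  rw [key]
  have hα : ‖α‖ ≤ √c := Real.le_sqrt_of_sq_le h1
  have hβ : ‖β‖ ≤ √c := Real.le_sqrt_of_sq_le h2
  calc _ ≤ ‖α‖ * ‖kron M N‖ * ‖β‖ := norm_bilin_le _ _ _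
    _ ≤ √c * ((‖φ‖ * 1) * (‖ψ‖ * 1)) * √c := by
      gcongr
      exact (norm_kron_le M N).trans (by gcongr)
    _ = ‖φ‖ * ‖ψ‖ * (√c * √c) := by ring
    _ = ‖φ‖ * ‖ψ‖ * projNorm u + ε * (‖φ‖ * ‖ψ‖ / (‖φ‖ * ‖ψ‖ + 1)) := by
      rw [Real.mul_self_sqrt hc0, hc]; ring
    _ ≤ ‖φ‖ * ‖ψ‖ * projNorm u + ε * 1 := by
      gcongr
      rw [div_le_one (by positivity)]
      linarith
    _ = _ := by rw [mul_one]

theorem projNorm_tmul_le (a : A) (b : B) : projNorm (a ⊗ₜ[ℂ] b) ≤ ‖a‖ * ‖b‖ := by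
  have h := projNorm_sandwich_le (WithLp.toLp 2 1 : EuclideanSpace ℂ (Unit × Unit))
    (CStarMatrix.toOneByOne Unit ℂ A a) (CStarMatrix.toOneByOne Unit ℂ B b) (WithLp.toLp 2 1)
  rw [StarAlgEquiv.norm_map, StarAlgEquiv.norm_map] at h
  have h1 : ‖(WithLp.toLp 2 1 : EuclideanSpace ℂ (Unit × Unit))‖ = 1 := by
    simp [EuclideanSpace.norm_eq]
  rw [h1, one_mul, mul_one] at h
  convert h
  simp only [sandwich, Pi.one_apply, mul_one, one_smul]
  rfl

end Functionals

end OpProj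

namespace RevTensor

variable {A : Type u} [CStarAlgebra A]

/-- The canonical map from `A ⊗ A`, as a linear map. -/
def ofTensorₗ (A : Type u) [CStarAlgebra A] : A ⊗[ℂ] A →ₗ[ℂ] RevTensor A where
  toFun := ofTensor
  map_add' := ofTensor_add
  map_smul' := ofTensor_smul

theorem ofTensor_one : ofTensor (1 ⊗ₜ[ℂ] 1) = (1 : RevTensor A) := rfl

theorem ofTensor_sub (x y : A ⊗[ℂ] A) : ofTensor (x - y) = ofTensor x - ofTensor y :=
  map_sub (ofTensorₗ A) x y

theorem star_ofTensor_tmul (a b : A) :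
    star (ofTensor (a ⊗ₜ[ℂ] b)) = ofTensor (star b ⊗ₜ[ℂ] star a) := by
  rw [star_ofTensor, OpProj.revStar_tmul]

theorem norm_ofTensor_tmul_le (a b : A) : ‖ofTensor (a ⊗ₜ[ℂ] b)‖ ≤ ‖a‖ * ‖b‖ :=
  (norm_ofTensor _).trans_le (OpProj.projNorm_tmul_le a b)

/-- The functional `φ ⊗ ψ` on `A ⊗̂_r A`. -/
def functional (φ ψ : A →L[ℂ] ℂ) : RevTensor A →L[ℂ] ℂ :=
  (OpProj.functionalTmul φ ψ).extendOfNorm (ofTensorₗ A)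

theorem functional_ofTensor_tmul (φ ψ : A →L[ℂ] ℂ) (a b : A) :
    functional φ ψ (ofTensor (a ⊗ₜ b)) = φ a * ψ b := by
  refine (LinearMap.extendOfNorm_eq (e := ofTensorₗ A) denseRange_ofTensor
    ⟨‖φ‖ * ‖ψ‖, fun x => ?_⟩ (a ⊗ₜ b)).trans (OpProj.functionalTmul_tmul φ ψ a b)
  exact (OpProj.norm_functionalTmul_le φ ψ x).trans_eq (by rw [← norm_ofTensor]; rfl)

/-- A closed condition stable under addition holds on all of `A ⊗̂_r A` once it holds for
elementary tensors. -/
theorem induction_tmul {p : RevTensor A → Prop} (hclosed : IsClosed {x | p x})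
    (tmul : ∀ a b : A, p (ofTensor (a ⊗ₜ b))) (add : ∀ x y, p x → p y → p (x + y))
    (x : RevTensor A) : p x := by
  refine denseRange_ofTensor.induction_on x hclosed fun t => ?_
  induction t with
  | zero =>
    have h := tmul 0 0
    rwa [TensorProduct.zero_tmul] at h
  | tmul a b => exact tmul a b
  | add s t hs ht =>
    rw [ofTensor_add]
    exact add _ _ hs ht

end RevTensor

/-! ### *-algebras consisting of scalars -/

section Scalars

variable {X : Type u} [Ring X] [StarRing X] [Algebra ℂ X] [StarModule ℂ X]

theorem isStarSemisimple_of_forall_scalar (h : ∀ x : X, ∃ c : ℂ, x = c • (1 : X)) :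
    IsStarSemisimple X := by
  refine Set.eq_singleton_iff_unique_mem.mpr ⟨fun H _ _ _ π => map_zero π, fun x hx => ?_⟩
  rcases subsingleton_or_nontrivial X with _ | _
  · exact Subsingleton.elim _ _
  have hbij : Function.Bijective (StarAlgHom.ofId ℂ X) := by
    refine ⟨(StarAlgHom.ofId ℂ X).toAlgHom.toRingHom.injective, fun x => ?_⟩
    obtain ⟨c, rfl⟩ := h x
    exact ⟨c, Algebra.algebraMap_eq_smul_one c⟩
  let e := StarAlgEquiv.ofBijective (StarAlgHom.ofId ℂ X) hbij
  -- A one-dimensional Hilbert space in the universe of `X`.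
  let H := EuclideanSpace ℂ PUnit.{u + 1}
  let π : X →⋆ₐ[ℂ] (H →L[ℂ] H) := (StarAlgHom.ofId ℂ (H →L[ℂ] H)).comp (e.symm : X →⋆ₐ[ℂ] ℂ)
  have hπ : π x = 0 := hx H π.toNonUnitalStarAlgHom
  exact (map_eq_zero_iff e.symm e.symm.injective).mp
    ((map_eq_zero_iff _ (StarAlgHom.ofId ℂ (H →L[ℂ] H)).toAlgHom.toRingHom.injective).mp hπ)

theorem isSymmetricStarAlgebra_of_forall_scalar (h : ∀ x : X, ∃ c : ℂ, x = c • (1 : X)) :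
    IsSymmetricStarAlgebra X := by
  intro x
  obtain ⟨c, rfl⟩ := h x
  have hc : (1 + star c * c : ℂ) ≠ 0 := by
    rw [RCLike.star_def, RCLike.conj_mul]
    norm_cast
    positivity
  have key : 1 + star (c • (1 : X)) * c • (1 : X) = algebraMap ℂ X (1 + star c * c) := by
    rw [star_smul, star_one, smul_mul_smul_comm, one_mul, Algebra.algebraMap_eq_smul_one,
      add_smul, one_smul]
  rw [key]
  exact (IsUnit.mk0 _ hc).map (algebraMap ℂ X)

end Scalars

theorem RevTensor.forall_scalar {A : Type u} [CStarAlgebra A]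
    (h : ∀ a : A, ∃ c : ℂ, a = c • (1 : A)) (x : RevTensor A) :
    ∃ c : ℂ, x = c • (1 : RevTensor A) := by
  suffices hx : x ∈ (ℂ ∙ (1 : RevTensor A)) by
    obtain ⟨c, rfl⟩ := Submodule.mem_span_singleton.mp hx
    exact ⟨c, rfl⟩
  refine RevTensor.induction_tmul (p := fun x => x ∈ (ℂ ∙ (1 : RevTensor A)))
    (Submodule.closed_of_finiteDimensional (ℂ ∙ (1 : RevTensor A))) (fun a b => ?_)
    (fun x y hx hy => add_mem hx hy) x
  obtain ⟨c, rfl⟩ := h a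
  obtain ⟨d, rfl⟩ := h b
  rw [TensorProduct.smul_tmul_smul, RevTensor.ofTensor_smul, RevTensor.ofTensor_one]
  exact Submodule.smul_mem _ _ (Submodule.mem_span_singleton_self _)

/-! ### The *-radical -/

/-- A *-homomorphism into a C*-algebra is bounded on self-adjoint elements: there the norm of the
image is a spectral radius. No continuity is assumed. -/
theorem IsSelfAdjoint.norm_map_le_of_banach {X B : Type*} [NormedRing X] [NormedAlgebra ℂ X]
    [CompleteSpace X] [StarRing X] [CStarAlgebra B] (π : X →⋆ₙₐ[ℂ] B) {y : X}
    (hy : IsSelfAdjoint y) : ‖π y‖ ≤ ‖y‖ * ‖(1 : X)‖ := by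
  rw [← (hy.map π).toReal_spectralRadius_complex_eq_norm]
  refine ENNReal.toReal_le_of_le_ofReal (by positivity) (iSup₂_le fun k hk => ?_)
  have hk' : k ∈ quasispectrum ℂ y :=
    NonUnitalAlgHom.quasispectrum_apply_subset (R := ℂ) π y (spectrum_subset_quasispectrum _ _ hk)
  rw [quasispectrum_eq_spectrum_union_zero] at hk'
  change ‖k‖ₑ ≤ _
  rw [← ofReal_norm]
  refine ENNReal.ofReal_le_ofReal ?_
  rcases hk' with hk' | rfl
  · exact spectrum.norm_le_norm_mul_of_mem hk'
  · rw [norm_zero]; positivity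

/-- Contractions that are mutually inverse in the corner of a projection `p` are adjoint. -/
theorem star_eq_of_mul_eq_projection {B : Type*} [CStarAlgebra B] {v w p : B}
    (hv : ‖v‖ ≤ 1) (hw : ‖w‖ ≤ 1) (hp : star p = p) (hvw : v * w = p) (hwv : w * v = p)
    (hvp : v * p = v) (hwp : w * p = w) : star w = v := by
  have contraction {x : B} (hx : ‖x‖ ≤ 1) (hxp : x * p = x) : star x * x ≤ star p * p := by
    have h1 : star x * x ≤ 1 := by
      rw [← CStarAlgebra.norm_le_one_iff_of_nonneg _ (star_mul_self_nonneg x),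
        CStarRing.norm_star_mul_self]
      exact mul_le_one₀ hx (norm_nonneg _) hx
    have h2 := star_left_conjugate_le_conjugate h1 p
    rw [mul_one] at h2
    convert h2 using 1
    conv_lhs => rw [← hxp]
    simp [mul_assoc]
  have hpp : p * p = p := by
    calc p * p = v * (w * p) := by rw [← mul_assoc, hvw]
      _ = p := by rw [hwp, hvw]
  have hpw : p * w = w := by rw [← hwv, mul_assoc, hvw, hwp]
  have hpv : p * v = v := by rw [← hvw, mul_assoc, hwv, hvp]
  have h1 : star w * w ≤ p := by simpa [hp, hpp] using contraction hw hwp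
  -- Conjugating `v* v ≤ p` by `w` gives the inequality opposite to `w* w ≤ p`.
  have h2 : p ≤ star w * w := by
    have h := star_left_conjugate_le_conjugate (contraction hv hvp) w
    have e1 : star w * (star v * v) * w = p := by
      calc star w * (star v * v) * w = star (v * w) * (v * w) := by simp [mul_assoc]
        _ = p := by rw [hvw, hp, hpp]
    have e2 : star w * (star p * p) * w = star w * w := by rw [hp, hpp, mul_assoc, hpw]
    rwa [e1, e2] at h
  have h3 : star w * w = p := le_antisymm h1 h2
  calc star w = star (p * w) := by rw [hpw]
    _ = star w * w * v := by rw [star_mul, hp, mul_assoc, hwv]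
    _ = v := by rw [h3, hpv]

namespace RevTensor

variable {A : Type u} [CStarAlgebra A]

/-- Representations need not be continuous a priori, but `(u ⊗ 1)* (u ⊗ 1) = u ⊗ u*` is self-adjoint
of norm at most `1`. -/
theorem norm_map_unitary_le {B : Type*} [CStarAlgebra B] (π : RevTensor A →⋆ₙₐ[ℂ] B)
    (u : unitary A) : ‖π (ofTensor ((u : A) ⊗ₜ 1))‖ ≤ 1 := by
  have hnorm (w : unitary A) : ‖(w : A)‖ ≤ 1 := by
    rcases subsingleton_or_nontrivial A with _ | _
    · simp [Subsingleton.elim (w : A) 0]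
    · exact (CStarRing.norm_coe_unitary w).le
  have hle (v w : unitary A) : ‖ofTensor ((v : A) ⊗ₜ[ℂ] (w : A))‖ ≤ 1 :=
    (norm_ofTensor_tmul_le _ _).trans (mul_le_one₀ (hnorm v) (norm_nonneg _) (hnorm w))
  set x := ofTensor ((u : A) ⊗ₜ[ℂ] (1 : A)) with hx
  have hxx : star x * x = ofTensor ((u : A) ⊗ₜ[ℂ] (star u : unitary A)) := by
    rw [hx, star_ofTensor_tmul, ← ofTensor_mul, Algebra.TensorProduct.tmul_mul_tmul, star_one,
      one_mul, mul_one, Unitary.coe_star]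
  have h := (IsSelfAdjoint.star_mul_self x).norm_map_le_of_banach π
  rw [map_mul, map_star, CStarRing.norm_star_mul_self] at h
  have h1 : ‖(1 : RevTensor A)‖ ≤ 1 := hle 1 1
  have h2 : ‖star x * x‖ ≤ 1 := hxx ▸ hle _ _
  have h3 := h.trans (mul_le_one₀ h2 (norm_nonneg _) h1)
  nlinarith [norm_nonneg (π x)]

/-- Every *-representation identifies `u ⊗ 1` with `1 ⊗ u`: the images of `u ⊗ 1` and `u* ⊗ 1` are
mutually inverse contractions, hence adjoint, while the adjoint of `u* ⊗ 1` is `1 ⊗ u`. -/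
theorem sub_mem_starRadical (u : unitary A) :
    ofTensor ((u : A) ⊗ₜ 1 - 1 ⊗ₜ (u : A)) ∈ starRadical (RevTensor A) := by
  intro H _ _ _ π
  have mul_tmul (a b : A) : π (ofTensor (a ⊗ₜ 1)) * π (ofTensor (b ⊗ₜ 1)) =
      π (ofTensor ((a * b) ⊗ₜ 1)) := by
    rw [← map_mul, ← ofTensor_mul, Algebra.TensorProduct.tmul_mul_tmul, one_mul]
  have key := star_eq_of_mul_eq_projection (p := π (ofTensor (1 ⊗ₜ 1)))
    (norm_map_unitary_le π u) (norm_map_unitary_le π (star u))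
    (by rw [← map_star, star_ofTensor_tmul, star_one])
    (by rw [mul_tmul, Unitary.coe_star, Unitary.mul_star_self_of_mem u.2])
    (by rw [mul_tmul, Unitary.coe_star, Unitary.star_mul_self_of_mem u.2])
    (by rw [mul_tmul, mul_one]) (by rw [mul_tmul, mul_one])
  rw [← map_star, star_ofTensor_tmul, star_one, Unitary.coe_star, star_star] at key
  rw [ofTensor_sub, map_sub, key, sub_self]

theorem scalar_of_ofTensor_sub_eq_zero {a : A} (h : ofTensor (a ⊗ₜ[ℂ] 1 - 1 ⊗ₜ a) = 0) :
    ∃ c : ℂ, a = c • (1 : A) := by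
  rcases subsingleton_or_nontrivial A with _ | _
  · exact ⟨0, Subsingleton.elim _ _⟩
  obtain ⟨ψ, hψ⟩ := SeparatingDual.exists_eq_one (R := ℂ) (one_ne_zero (α := A))
  refine ⟨ψ a, (SeparatingDual.eq_iff_forall_dual_eq (R := ℂ)).mpr fun φ => ?_⟩
  have h' := congrArg (functional φ ψ) h
  rw [ofTensor_sub, map_sub, functional_ofTensor_tmul, functional_ofTensor_tmul, hψ, map_zero,
    mul_one, sub_eq_zero] at h'
  rw [h', map_smul, smul_eq_mul, mul_comm]

theorem scalar_of_isStarSemisimple (h : IsStarSemisimple (RevTensor A)) (a : A) :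
    ∃ c : ℂ, a = c • (1 : A) := by
  suffices ha : a ∈ (ℂ ∙ (1 : A)) by
    obtain ⟨c, rfl⟩ := Submodule.mem_span_singleton.mp ha
    exact ⟨c, rfl⟩
  have hspan : a ∈ Submodule.span ℂ (unitary A : Set A) := by
    rw [CStarAlgebra.span_unitary]; trivial
  refine Submodule.span_le.mpr (fun u hu => ?_) hspan
  have hmem := sub_mem_starRadical ⟨u, hu⟩
  rw [h] at hmem
  obtain ⟨c, hc⟩ := scalar_of_ofTensor_sub_eq_zero hmem
  exact Submodule.mem_span_singleton.mpr ⟨c, hc.symm⟩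

end RevTensor

/-! ### Eigenfunctionals and symmetry -/

theorem Submodule.exists_functional_of_isClosed {E : Type*} [NormedAddCommGroup E]
    [NormedSpace ℂ E] {p : Submodule ℂ E} (hp : IsClosed (p : Set E)) {x : E} (hx : x ∉ p) :
    ∃ φ : E →L[ℂ] ℂ, φ x ≠ 0 ∧ ∀ y ∈ p, φ y = 0 := by
  have : IsClosed (p : Set E) := hp
  obtain ⟨g, hg⟩ := SeparatingDual.exists_ne_zero (R := ℂ)
    (mt (Submodule.Quotient.mk_eq_zero p).mp hx)
  exact ⟨g.comp p.mkQL, hg, fun y hy => by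
    change g (Submodule.Quotient.mk y) = 0
    rw [(Submodule.Quotient.mk_eq_zero p).mpr hy, map_zero]⟩

/-- A point of the spectrum of a self-adjoint element `a` has an eigenfunctional: as `a - s` has no
left inverse, the closed left ideal it generates is proper. -/
theorem IsSelfAdjoint.exists_left_eigenfunctional {A : Type*} [CStarAlgebra A] {a : A}
    (ha : IsSelfAdjoint a) {s : ℂ} (hs : s ∈ spectrum ℂ a) :
    ∃ φ : A →L[ℂ] ℂ, φ 1 ≠ 0 ∧ ∀ c, φ (c * a) = s * φ c := by
  set b := algebraMap ℂ A s - a with hb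
  have hsa : IsSelfAdjoint b := by
    refine IsSelfAdjoint.sub ?_ ha
    rw [ha.mem_spectrum_eq_re hs]
    exact IsSelfAdjoint.algebraMap A (Complex.conj_ofReal s.re)
  let I : Ideal A := Ideal.span {b}
  have hI : I ≠ ⊤ := by
    intro h
    obtain ⟨c, hc⟩ := Ideal.mem_span_singleton'.mp ((Ideal.eq_top_iff_one I).mp h)
    have hc' : b * star c = 1 := by simpa [hsa.star_eq] using congrArg star hc
    exact hs ⟨⟨b, c, by rwa [left_inv_eq_right_inv hc hc'], hc⟩, rfl⟩
  have h1 : (1 : A) ∉ I.closure.restrictScalars ℂ :=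
    mt (Ideal.eq_top_iff_one _).mpr (I.closure_ne_top hI)
  obtain ⟨φ, hφ1, hφ⟩ := Submodule.exists_functional_of_isClosed
    (p := I.closure.restrictScalars ℂ) isClosed_closure h1
  refine ⟨φ, hφ1, fun c => ?_⟩
  have h := hφ (c * b) (subset_closure (I.mul_mem_left c (Ideal.mem_span_singleton_self b)))
  rw [hb, mul_sub, map_sub, ← Algebra.commutes, ← Algebra.smul_def, map_smul, smul_eq_mul,
    sub_eq_zero] at h
  exact h.symm

namespace RevTensor

variable {A : Type u} [CStarAlgebra A]

/-- If `s ≠ t` are spectral values of `a`, then `1` is a spectral value of the skew-adjoint element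
`x = (s - t)⁻¹ (a ⊗ 1 - 1 ⊗ a)`, so that `1 + x* x = 1 - x²` is not invertible. -/
theorem spectrum_subsingleton_of_isSymmetric (h : IsSymmetricStarAlgebra (RevTensor A)) {a : A}
    (ha : IsSelfAdjoint a) {s t : ℂ} (hs : s ∈ spectrum ℂ a) (ht : t ∈ spectrum ℂ a) : s = t := by
  by_contra hst
  obtain ⟨φ, hφ1, hφ⟩ := ha.exists_left_eigenfunctional hs
  obtain ⟨ψ, hψ1, hψ⟩ := ha.exists_left_eigenfunctional ht
  let F := functional φ ψ
  let r : ℂ := (s - t)⁻¹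
  have hr : star r = r := by
    simp only [r]
    rw [ha.mem_spectrum_eq_re hs, ha.mem_spectrum_eq_re ht]
    simp
  let x : RevTensor A := r • ofTensor (a ⊗ₜ 1 - 1 ⊗ₜ a)
  have hx : star x = -x := by
    simp only [x, ofTensor_sub, star_smul, star_sub, star_ofTensor_tmul, star_one, ha.star_eq, hr,
      ← smul_neg, neg_sub]
  have hF (y : RevTensor A) : F (y * x) = F y := by
    refine induction_tmul (p := fun y => F (y * x) = F y)
      (isClosed_eq (F.continuous.comp (continuous_mul_const x)) F.continuous) (fun b c => ?_)
      (fun y z hy hz => by rw [add_mul, map_add, map_add, hy, hz]) y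
    simp only [x, F]
    rw [mul_smul_comm, map_smul, ← ofTensor_mul, mul_sub, Algebra.TensorProduct.tmul_mul_tmul,
      Algebra.TensorProduct.tmul_mul_tmul, ofTensor_sub, map_sub, functional_ofTensor_tmul,
      functional_ofTensor_tmul, functional_ofTensor_tmul, hφ, hψ, mul_one, mul_one, smul_eq_mul]
    have : s - t ≠ 0 := sub_ne_zero.mpr hst
    simp only [r]
    field_simp
  obtain ⟨z, hz⟩ := (h x).exists_left_inv
  have h1 : F 1 = φ 1 * ψ 1 := functional_ofTensor_tmul φ ψ 1 1
  refine mul_ne_zero hφ1 hψ1 ?_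
  rw [← h1, ← hz, hx, mul_add, mul_one, neg_mul, mul_neg, map_add, map_neg, ← mul_assoc, hF, hF,
    add_neg_cancel]

theorem scalar_of_isSymmetric (h : IsSymmetricStarAlgebra (RevTensor A)) (a : A) :
    ∃ c : ℂ, a = c • (1 : A) := by
  rcases subsingleton_or_nontrivial A with _ | _
  · exact ⟨0, Subsingleton.elim _ _⟩
  have scalar {b : A} (hb : IsSelfAdjoint b) : ∃ c : ℂ, b = c • (1 : A) := by
    obtain ⟨s, hs⟩ := spectrum.nonempty b
    refine ⟨s, ?_⟩
    rw [← Algebra.algebraMap_eq_smul_one]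
    have := hb.isStarNormal
    exact CFC.eq_algebraMap_of_spectrum_subset_singleton b s fun t ht =>
      spectrum_subsingleton_of_isSymmetric h hb ht hs
  obtain ⟨c, hc⟩ := scalar (realPart a).2
  obtain ⟨d, hd⟩ := scalar (imaginaryPart a).2
  refine ⟨c + Complex.I * d, ?_⟩
  rw [add_smul, mul_smul, ← hc, ← hd, realPart_add_I_smul_imaginaryPart]

end RevTensor

end

theorem mainTheorem11 (A : Type*) [CStarAlgebra A] :
    (IsStarSemisimple (RevTensor A) ↔ ∀ a : A, ∃ c : ℂ, a = c • (1 : A)) ∧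
      (IsSymmetricStarAlgebra (RevTensor A) ↔ ∀ a : A, ∃ c : ℂ, a = c • (1 : A)) :=
  ⟨⟨RevTensor.scalar_of_isStarSemisimple, fun h =>
      isStarSemisimple_of_forall_scalar (RevTensor.forall_scalar h)⟩,
    ⟨RevTensor.scalar_of_isSymmetric, fun h =>
      isSymmetricStarAlgebra_of_forall_scalar (RevTensor.forall_scalar h)⟩⟩
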